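/- Let $D$ be a skew field (a possibly noncommutative field), $\sigma : D \to D$ a ring automorphism, and $\delta : D \to D$ a $\sigma$-derivation, that is, an additive map with $\delta(ab) = \sigma(a)\delta(b) + \delta(a)b$ for all $a,b \in D$. Let $R = D[X;\sigma,\delta]$ be the corresponding Ore extension: the ring of left polynomials $\sum_n a_n X^n$ with $a_n \in D$, whose product is determined by $Xa = \sigma(a)X + \delta(a)$. Let $\deg$ denote the degree of left polynomials in $X$, with $\deg 0 = -\infty$. A bound of $f \in R$ is an element $f^* \in R$ such that $Rf^* = f^*R$ and this is the largest twosided ideal of $R$ contained in the left ideal $Rf$. Theorem. Assume that $R$ is a finitely generated free module of rank $r$ over its center $C$. Let $f \in R$ have a bound $f^*$ that lies in $C$. Then $\deg f^* \leq \sqrt{r}\,\deg f$. -/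

import Mathlib

/-- A `σ`-derivation of a ring `D`: an additive map `δ : D → D` such that
`δ (a * b) = σ a * δ b + δ a * b`. -/
structure SigmaDerivation {D : Type*} [Ring D] (σ : D ≃+* D) extends D →+ D where
  leibniz' : ∀ a b : D, toFun (a * b) = σ a * toFun b + toFun a * b

instance {D : Type*} [Ring D] (σ : D ≃+* D) : CoeFun (SigmaDerivation σ) (fun _ => D → D) :=
  ⟨fun δ => δ.toAddMonoidHom⟩

theorem SigmaDerivation.leibniz {D : Type*} [Ring D] {σ : D ≃+* D} (δ : SigmaDerivation σ)
    (a b : D) : δ (a * b) = σ a * δ b + δ a * b := δ.leibniz' a b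

/-- The underlying set of the Ore extension `D[X; σ, δ]`: finitely supported sequences of
coefficients, the sequence `(a₀, a₁, …)` standing for the left polynomial `∑ aₙ Xⁿ`. -/
def OrePolynomial {D : Type*} [Ring D] (σ : D ≃+* D) (_δ : SigmaDerivation σ) : Type _ := ℕ →₀ D

namespace OrePolynomial

noncomputable section

variable {D : Type*} [Ring D] {σ : D ≃+* D} {δ : SigmaDerivation σ}

instance : AddCommGroup (OrePolynomial σ δ) := inferInstanceAs (AddCommGroup (ℕ →₀ D))

/-- Left multiplication of left polynomials by scalars makes them a left `D`-module. -/
instance : Module D (OrePolynomial σ δ) := inferInstanceAs (Module D (ℕ →₀ D))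

/-- The coefficient of `Xⁿ`, with coefficients written on the left. -/
def coeff (f : OrePolynomial σ δ) (n : ℕ) : D := (show ℕ →₀ D from f) n

/-- The set of exponents with a nonzero coefficient. -/
def support (f : OrePolynomial σ δ) : Finset ℕ := Finsupp.support (show ℕ →₀ D from f)

theorem mem_support {f : OrePolynomial σ δ} {n : ℕ} : n ∈ f.support ↔ f.coeff n ≠ 0 :=
  Finsupp.mem_support_iff

@[ext] theorem ext {f g : OrePolynomial σ δ} (h : ∀ n, f.coeff n = g.coeff n) : f = g :=
  Finsupp.ext h

/-- The degree; `degree 0 = ⊥` plays the role of `-∞`. -/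
def degree (f : OrePolynomial σ δ) : WithBot ℕ := f.support.max

variable (σ δ) in
/-- The monomial `a Xⁿ`, as an additive function of `a`. -/
def monomial (n : ℕ) : D →+ OrePolynomial σ δ := Finsupp.singleAddHom n

theorem coeff_monomial (n m : ℕ) (a : D) :
    (monomial σ δ n a).coeff m = if n = m then a else 0 := by
  classical
  exact Finsupp.single_apply

theorem smul_monomial (n : ℕ) (a b : D) :
    a • monomial σ δ n b = monomial σ δ n (a * b) := Finsupp.smul_single a n b

theorem addHom_ext {M : Type*} [AddZeroClass M] {F G : OrePolynomial σ δ →+ M}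
    (h : ∀ n a, F (monomial σ δ n a) = G (monomial σ δ n a)) : F = G :=
  Finsupp.addHom_ext h

theorem end_mul_apply {A : Type*} [AddCommGroup A] (F G : AddMonoid.End A) (x : A) :
    (F * G) x = F (G x) := rfl

theorem end_add_apply {A : Type*} [AddCommGroup A] (F G : AddMonoid.End A) (x : A) :
    (F + G) x = F x + G x := rfl

variable (σ δ) in
/-- Left multiplication by `X`: it sends `a Xⁿ` to `σ(a) Xⁿ⁺¹ + δ(a) Xⁿ`. -/
def mulX : AddMonoid.End (OrePolynomial σ δ) :=
  Finsupp.liftAddHom (fun n : ℕ =>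
    (monomial σ δ (n + 1)).comp (σ : D →+ D) + (monomial σ δ n).comp δ.toAddMonoidHom)

theorem mulX_monomial (n : ℕ) (a : D) :
    mulX σ δ (monomial σ δ n a) = monomial σ δ (n + 1) (σ a) + monomial σ δ n (δ a) :=
  Finsupp.liftAddHom_apply_single _ _ _

variable (σ δ) in
/-- Left multiplication by a scalar. -/
def mulC : D →+* AddMonoid.End (OrePolynomial σ δ) := Module.toAddMonoidEnd D (OrePolynomial σ δ)

theorem mulC_apply (a : D) (f : OrePolynomial σ δ) : mulC σ δ a f = a • f := rfl

theorem mulX_mul_mulC (a : D) :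
    mulX σ δ * mulC σ δ a = mulC σ δ (σ a) * mulX σ δ + mulC σ δ (δ a) := by
  refine addHom_ext fun n b => ?_
  change mulX σ δ (mulC σ δ a (monomial σ δ n b)) =
    mulC σ δ (σ a) (mulX σ δ (monomial σ δ n b)) + mulC σ δ (δ a) (monomial σ δ n b)
  simp only [mulC_apply, smul_monomial,
    mulX_monomial, map_mul, SigmaDerivation.leibniz, map_add]
  abel

variable (σ δ) in
/-- Left multiplication by the polynomial `∑ aₙ Xⁿ`, as the operator `∑ aₙ ∘ (X ·)ⁿ`. -/
def mulLeft : OrePolynomial σ δ →+ AddMonoid.End (OrePolynomial σ δ) :=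
  Finsupp.liftAddHom (fun n : ℕ =>
    (AddMonoidHom.mulRight (mulX σ δ ^ n)).comp (mulC σ δ : D →+ _))

theorem mulLeft_monomial (n : ℕ) (a : D) :
    mulLeft σ δ (monomial σ δ n a) = mulC σ δ a * mulX σ δ ^ n :=
  Finsupp.liftAddHom_apply_single _ _ _

instance : One (OrePolynomial σ δ) := ⟨monomial σ δ 0 1⟩

/-- The product: the one determined by biadditivity, left `D`-linearity,
`Xⁿ Xᵐ = Xⁿ⁺ᵐ` and `X a = σ(a) X + δ(a)`. -/
instance : Mul (OrePolynomial σ δ) := ⟨fun f g => mulLeft σ δ f g⟩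

theorem one_def : (1 : OrePolynomial σ δ) = monomial σ δ 0 1 := rfl

theorem mul_def (f g : OrePolynomial σ δ) : f * g = mulLeft σ δ f g := rfl

theorem mulLeft_mulC (a : D) (g : OrePolynomial σ δ) :
    mulLeft σ δ (mulC σ δ a g) = mulC σ δ a * mulLeft σ δ g := by
  refine DFunLike.congr_fun (addHom_ext (F := (mulLeft σ δ).comp (mulC σ δ a))
    (G := (AddMonoidHom.mulLeft (mulC σ δ a)).comp (mulLeft σ δ)) fun n b => ?_) g
  change mulLeft σ δ (mulC σ δ a (monomial σ δ n b)) =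
    mulC σ δ a * mulLeft σ δ (monomial σ δ n b)
  rw [mulC_apply, smul_monomial, mulLeft_monomial, mulLeft_monomial, map_mul, mul_assoc]

theorem mulLeft_mulX (g : OrePolynomial σ δ) :
    mulLeft σ δ (mulX σ δ g) = mulX σ δ * mulLeft σ δ g := by
  refine DFunLike.congr_fun (addHom_ext (F := (mulLeft σ δ).comp (mulX σ δ))
    (G := (AddMonoidHom.mulLeft (mulX σ δ)).comp (mulLeft σ δ)) fun n b => ?_) g
  change mulLeft σ δ (mulX σ δ (monomial σ δ n b)) =
    mulX σ δ * mulLeft σ δ (monomial σ δ n b)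
  simp only [mulX_monomial, map_add, mulLeft_monomial]
  rw [← mul_assoc, mulX_mul_mulC, add_mul, mul_assoc, ← pow_succ']

theorem mulLeft_mulX_pow (n : ℕ) (g : OrePolynomial σ δ) :
    mulLeft σ δ ((mulX σ δ ^ n) g) = mulX σ δ ^ n * mulLeft σ δ g := by
  induction n with
  | zero => simp
  | succ k ih => rw [pow_succ', end_mul_apply, mulLeft_mulX, ih, mul_assoc]

theorem mulLeft_mul (f g : OrePolynomial σ δ) :
    mulLeft σ δ (f * g) = mulLeft σ δ f * mulLeft σ δ g := by
  refine DFunLike.congr_fun (addHom_ext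
    (F := (mulLeft σ δ).comp ((AddMonoidHom.eval g).comp (mulLeft σ δ)))
    (G := (AddMonoidHom.mulRight (mulLeft σ δ g)).comp (mulLeft σ δ)) fun n b => ?_) f
  change mulLeft σ δ (mulLeft σ δ (monomial σ δ n b) g) =
    mulLeft σ δ (monomial σ δ n b) * mulLeft σ δ g
  rw [mulLeft_monomial, end_mul_apply, mulLeft_mulC, mulLeft_mulX_pow, mul_assoc]

theorem mulX_pow_one (n : ℕ) :
    (mulX σ δ ^ n) (1 : OrePolynomial σ δ) = monomial σ δ n 1 := by
  induction n with
  | zero => simp [one_def]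
  | succ k ih =>
    have h : δ (1 : D) = 0 := by simpa using δ.leibniz 1 1
    rw [pow_succ', end_mul_apply, ih, mulX_monomial, h]
    simp

theorem mulLeft_one_right (f : OrePolynomial σ δ) : mulLeft σ δ f 1 = f := by
  refine DFunLike.congr_fun (addHom_ext
    (F := (AddMonoidHom.eval (1 : OrePolynomial σ δ)).comp (mulLeft σ δ))
    (G := AddMonoidHom.id _) fun n b => ?_) f
  change mulLeft σ δ (monomial σ δ n b) 1 = monomial σ δ n b
  rw [mulLeft_monomial, end_mul_apply, mulX_pow_one, mulC_apply, smul_monomial, mul_one]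

theorem mulLeft_one : mulLeft σ δ 1 = 1 := by
  rw [one_def, mulLeft_monomial, map_one, pow_zero, one_mul]

/-- The Ore extension `D[X; σ, δ]` is a ring. -/
instance : Ring (OrePolynomial σ δ) where
  __ := (inferInstance : AddCommGroup (OrePolynomial σ δ))
  left_distrib f g h := map_add (mulLeft σ δ f) g h
  right_distrib f g h := by
    simp only [mul_def, map_add, end_add_apply]
  zero_mul f := by
    rw [mul_def, map_zero]
    rfl
  mul_zero f := map_zero (mulLeft σ δ f)
  mul_assoc f g h := by
    rw [mul_def (f * g), mulLeft_mul]
    rfl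
  one_mul f := by
    rw [mul_def, mulLeft_one]
    rfl
  mul_one f := mulLeft_one_right f

variable (σ δ) in
/-- The inclusion of the coefficient ring as constant polynomials. -/
def C : D →+* OrePolynomial σ δ where
  toFun := monomial σ δ 0
  map_one' := rfl
  map_zero' := map_zero _
  map_add' := map_add _
  map_mul' a b := by
    rw [mul_def, mulLeft_monomial, pow_zero, mul_one, mulC_apply, smul_monomial]

variable (σ δ) in
/-- The variable. -/
def X : OrePolynomial σ δ := monomial σ δ 1 1

theorem C_mul (a : D) (f : OrePolynomial σ δ) : C σ δ a * f = a • f := by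
  change mulLeft σ δ (monomial σ δ 0 a) f = a • f
  rw [mulLeft_monomial, pow_zero, mul_one, mulC_apply]

theorem X_mul (f : OrePolynomial σ δ) : X σ δ * f = mulX σ δ f := by
  change mulLeft σ δ (monomial σ δ 1 1) f = mulX σ δ f
  rw [mulLeft_monomial, pow_one, map_one, one_mul]

theorem X_pow (n : ℕ) : X σ δ ^ n = monomial σ δ n 1 := by
  induction n with
  | zero => rfl
  | succ k ih =>
    rw [pow_succ', ih, X_mul, ← mulX_pow_one, ← mulX_pow_one, pow_succ', end_mul_apply]

theorem C_mul_X_pow (n : ℕ) (a : D) : C σ δ a * X σ δ ^ n = monomial σ δ n a := by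
  rw [C_mul, X_pow, smul_monomial, mul_one]

/-- The defining commutation rule of the Ore extension. -/
theorem X_mul_C (a : D) : X σ δ * C σ δ a = C σ δ (σ a) * X σ δ + C σ δ (δ a) := by
  rw [X_mul, C_mul]
  change mulX σ δ (monomial σ δ 0 a) = σ a • monomial σ δ 1 1 + monomial σ δ 0 (δ a)
  rw [mulX_monomial, smul_monomial, mul_one]

/-- Every element is the left polynomial given by its coefficients. -/
theorem eq_sum (f : OrePolynomial σ δ) :
    f = ∑ n ∈ f.support, C σ δ (f.coeff n) * X σ δ ^ n := by
  simp only [C_mul_X_pow]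
  exact (Finsupp.sum_single (show ℕ →₀ D from f)).symm

end

end OrePolynomial

/-- `g` is a twosided (normal) element of `R`: `R g = g R`. -/
def IsTwoSidedElement {R : Type*} [Ring R] (g : R) : Prop :=
  Set.range (fun h : R => h * g) = Set.range (fun h : R => g * h)

/-- `g` is a bound of `f`: `R g = g R`, and this is the largest twosided ideal contained in the
left ideal `R f`. (In Mathlib an `Ideal` of a noncommutative ring is a left ideal.) -/
structure IsBound {R : Type*} [Ring R] (f g : R) : Prop where
  twoSided : IsTwoSidedElement g
  isGreatest : IsGreatest {I : Ideal R | I.IsTwoSided ∧ I ≤ Ideal.span {f}} (Ideal.span {g})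

/-! For `f ≠ 0` it suffices to find `g ≠ 0` in `Rf` with `gR ⊆ Rg` and `deg g ≤ √r · deg f`: then
`Rg` is a twosided ideal inside `Rf`, so `g` is a left multiple of the bound, and degrees add in
products.

Such `g` multiply along factorizations of `f`, so `exists_normal_mem_span` reduces to `Rf` maximal,
that is, to `M = R/Rf` simple. There `g` is a generator of the annihilator of `M`. As in the density
theorem, take a tuple `x` in `M` of maximal length `m` with `R → Mᵐ`, `a ↦ ax`, onto; by maximality,
whatever kills `x` kills `M` (`exists_forall_smul_eq_zero`). Since `Mᵐ` has dimension at most `m ·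
deg f` over `D`, some nonzero polynomial of degree at most `m · deg f` kills `x`
(`exists_mul_mem_span`).

Finally `m² ≤ r` (`mul_self_le_finrank_center`): `M` is a vector space over a residue field `k` of
the center, `x` is independent over `k`, so `m ≤ dim M`, and surjectivity onto `Mᵐ` gives `m · dim M
≤ r`. -/

namespace OrePolynomial

/-! ### Degrees and leading coefficients -/

section Degree

variable {D : Type*} [Ring D] {σ : D ≃+* D} {δ : SigmaDerivation σ}

theorem coeff_add (f g : OrePolynomial σ δ) (n : ℕ) :
    (f + g).coeff n = f.coeff n + g.coeff n := rfl

theorem coeff_sub (f g : OrePolynomial σ δ) (n : ℕ) :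
    (f - g).coeff n = f.coeff n - g.coeff n := rfl

theorem coeff_smul (a : D) (f : OrePolynomial σ δ) (n : ℕ) :
    (a • f).coeff n = a * f.coeff n := rfl

variable (σ δ) in
/-- Taking the coefficient of `Xⁿ`, as a linear map. -/
noncomputable def lcoeff (n : ℕ) : OrePolynomial σ δ →ₗ[D] D where
  toFun f := f.coeff n
  map_add' f g := coeff_add f g n
  map_smul' a f := coeff_smul a f n

theorem coeff_sum {ι : Type*} (s : Finset ι) (F : ι → OrePolynomial σ δ) (n : ℕ) :
    (∑ i ∈ s, F i).coeff n = ∑ i ∈ s, (F i).coeff n :=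
  map_sum (lcoeff σ δ n) F s

theorem coeff_X_mul_succ (f : OrePolynomial σ δ) (k : ℕ) :
    (X σ δ * f).coeff (k + 1) = σ (f.coeff k) + δ (f.coeff (k + 1)) := by
  rw [X_mul]
  refine DFunLike.congr_fun (addHom_ext
    (F := (lcoeff σ δ (k + 1)).toAddMonoidHom.comp (mulX σ δ))
    (G := (σ : D →+ D).comp (lcoeff σ δ k).toAddMonoidHom +
      δ.toAddMonoidHom.comp (lcoeff σ δ (k + 1)).toAddMonoidHom) fun n a => ?_) f
  change (mulX σ δ (monomial σ δ n a)).coeff (k + 1) =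
    σ ((monomial σ δ n a).coeff k) + δ ((monomial σ δ n a).coeff (k + 1))
  rw [mulX_monomial, coeff_add, coeff_monomial, coeff_monomial, coeff_monomial, coeff_monomial]
  simp only [Nat.add_right_cancel_iff]
  split_ifs <;> simp_all

theorem coeff_X_pow_mul_eq_zero {f : OrePolynomial σ δ} {n : ℕ} (hf : ∀ k, n < k → f.coeff k = 0)
    (i : ℕ) : ∀ k, i + n < k → (X σ δ ^ i * f).coeff k = 0 := by
  induction i with
  | zero => simpa using hf
  | succ i ih =>
    intro k hk
    obtain ⟨k, rfl⟩ : ∃ l, k = l + 1 := ⟨k - 1, by omega⟩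
    rw [pow_succ', mul_assoc, coeff_X_mul_succ, ih k (by omega), ih (k + 1) (by omega)]
    simp

/-- Each factor `X` twists the leading coefficient by `σ`; the `δ`-term only sees the vanishing
coefficient one place higher. -/
theorem coeff_X_pow_mul {f : OrePolynomial σ δ} {n : ℕ} (hf : ∀ k, n < k → f.coeff k = 0)
    (i : ℕ) : (X σ δ ^ i * f).coeff (i + n) = (σ ^ i) (f.coeff n) := by
  induction i with
  | zero => simp
  | succ i ih =>
    rw [pow_succ', mul_assoc, show i + 1 + n = (i + n) + 1 by omega, coeff_X_mul_succ, ih,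
      coeff_X_pow_mul_eq_zero hf i _ (by omega), pow_succ']
    simp

theorem degree_eq_coe_iff {f : OrePolynomial σ δ} {n : ℕ} :
    f.degree = n ↔ f.coeff n ≠ 0 ∧ ∀ k, n < k → f.coeff k = 0 := by
  constructor
  · intro h
    refine ⟨mem_support.1 (Finset.mem_of_max h), fun k hk => ?_⟩
    by_contra hc
    exact absurd (show k ≤ n from Finset.le_max_of_eq (mem_support.2 hc) h) (by omega)
  · rintro ⟨h, h'⟩
    refine le_antisymm (Finset.max_le fun k hk => ?_) (Finset.le_max (mem_support.2 h))
    by_contra hc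
    exact mem_support.1 hk (h' k (WithBot.coe_lt_coe.1 (not_le.1 hc)))

theorem exists_degree_eq {f : OrePolynomial σ δ} (hf : f ≠ 0) : ∃ n : ℕ, f.degree = n := by
  have : f.support.Nonempty := by
    by_contra h
    refine hf (ext fun n => ?_)
    by_contra hn
    exact h ⟨n, mem_support.2 hn⟩
  exact Finset.max_of_nonempty this

theorem degree_zero : (0 : OrePolynomial σ δ).degree = ⊥ := rfl

theorem ne_zero_of_degree_eq {f : OrePolynomial σ δ} {n : ℕ} (hf : f.degree = n) : f ≠ 0 := by
  rintro rfl
  exact (degree_eq_coe_iff.1 hf).1 rfl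

theorem degree_one [Nontrivial D] : (1 : OrePolynomial σ δ).degree = (0 : ℕ) := by
  rw [degree_eq_coe_iff, one_def]
  refine ⟨by simp [coeff_monomial], fun k hk => ?_⟩
  rw [coeff_monomial, if_neg (by omega)]

theorem coeff_mul (f g : OrePolynomial σ δ) (k : ℕ) :
    (f * g).coeff k = ∑ i ∈ f.support, f.coeff i * (X σ δ ^ i * g).coeff k := by
  conv_lhs => rw [eq_sum f, Finset.sum_mul, coeff_sum]
  refine Finset.sum_congr rfl fun i _ => ?_
  rw [mul_assoc, C_mul, coeff_smul]

theorem degree_mul [NoZeroDivisors D] {f g : OrePolynomial σ δ} {n m : ℕ} (hf : f.degree = n)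
    (hg : g.degree = m) : (f * g).degree = (n + m : ℕ) := by
  rw [degree_eq_coe_iff] at *
  obtain ⟨hf, hf'⟩ := hf
  obtain ⟨hg, hg'⟩ := hg
  have hs : ∀ i ∈ f.support, i ≤ n := fun i hi => by
    by_contra h
    exact mem_support.1 hi (hf' i (by omega))
  refine ⟨?_, fun k hk => ?_⟩
  · rw [coeff_mul, Finset.sum_eq_single n, coeff_X_pow_mul hg']
    · exact mul_ne_zero hf ((map_ne_zero_iff _ (σ ^ n).injective).2 hg)
    · intro i hi hin
      have := hs i hi
      rw [coeff_X_pow_mul_eq_zero hg' i _ (by omega), mul_zero]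
    · intro h
      exact absurd (mem_support.2 hf) h
  · rw [coeff_mul]
    refine Finset.sum_eq_zero fun i hi => ?_
    have := hs i hi
    rw [coeff_X_pow_mul_eq_zero hg' i _ (by omega), mul_zero]

end Degree

/-! ### Right division, left ideals and factorizations -/

section Division

variable {D : Type*} [DivisionRing D] {σ : D ≃+* D} {δ : SigmaDerivation σ}

/-- Right division with remainder. -/
theorem exists_eq_mul_add {f : OrePolynomial σ δ} {n : ℕ} (hf : f.degree = n)
    (g : OrePolynomial σ δ) :
    ∃ q s : OrePolynomial σ δ, g = q * f + s ∧ ∀ k, n ≤ k → s.coeff k = 0 := by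
  obtain ⟨hn, hn'⟩ := degree_eq_coe_iff.1 hf
  suffices H : ∀ (N : ℕ) (g : OrePolynomial σ δ), (∀ k, N ≤ k → g.coeff k = 0) →
      ∃ q s : OrePolynomial σ δ, g = q * f + s ∧ ∀ k, n ≤ k → s.coeff k = 0 by
    refine H (g.support.sup id + 1) g fun k hk => ?_
    by_contra hc
    have := Finset.le_sup (f := id) (mem_support.2 hc)
    simp only [id] at this
    omega
  intro N
  induction N with
  | zero => exact fun g hg => ⟨0, g, by simp, fun k _ => hg k (Nat.zero_le k)⟩
  | succ N ih =>
    intro g hg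
    by_cases hN : N < n
    · exact ⟨0, g, by simp, fun k hk => hg k (by omega)⟩
    have hne : (σ ^ (N - n)) (f.coeff n) ≠ 0 :=
      (map_ne_zero_iff _ (σ ^ (N - n)).injective).2 hn
    -- The scalar undoes the twist by `σ ^ (N - n)`, so that `t * f` has the same coefficient at `N`
    -- as `g`.
    set t := C σ δ (g.coeff N * ((σ ^ (N - n)) (f.coeff n))⁻¹) * X σ δ ^ (N - n)
    obtain ⟨q, s, h, hs⟩ := ih (g - t * f) fun k hk => by
      rw [coeff_sub, mul_assoc, C_mul, coeff_smul]
      rcases hk.eq_or_lt with rfl | hk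
      · have := coeff_X_pow_mul hn' (N - n)
        rw [show N - n + n = N by omega] at this
        rw [this, mul_assoc, inv_mul_cancel₀ hne, mul_one, sub_self]
      · rw [hg k (by omega), coeff_X_pow_mul_eq_zero hn' _ k (by omega), mul_zero, sub_self]
    exact ⟨t + q, s, by rw [add_mul, add_assoc, ← h]; abel, hs⟩

/-- Every nonzero left ideal is generated by an element of minimal degree. -/
theorem exists_ideal_eq_span {J : Ideal (OrePolynomial σ δ)} {g₀ : OrePolynomial σ δ} {n : ℕ}
    (hg₀ : g₀ ∈ J) (hn : g₀.degree = n) :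
    ∃ (g : OrePolynomial σ δ) (k : ℕ), J = Ideal.span {g} ∧ g.degree = k ∧ k ≤ n := by
  classical
  have hex : ∃ k : ℕ, ∃ g ∈ J, g.degree = k := ⟨n, g₀, hg₀, hn⟩
  obtain ⟨g, hgJ, hg⟩ := Nat.find_spec hex
  refine ⟨g, _, le_antisymm (fun a ha => ?_) (by simpa [Ideal.span_le] using hgJ), hg,
    Nat.find_min' hex ⟨g₀, hg₀, hn⟩⟩
  obtain ⟨q, s, rfl, hs⟩ := exists_eq_mul_add hg a
  have hsJ : s ∈ J := by simpa using J.sub_mem ha (J.mul_mem_left q hgJ)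
  have : s = 0 := by
    by_contra h
    obtain ⟨k, hk⟩ := exists_degree_eq h
    have h1 := Nat.find_min' hex ⟨s, hsJ, hk⟩
    exact (degree_eq_coe_iff.1 hk).1 (hs k h1)
  rw [this, add_zero]
  exact Ideal.mem_span_singleton'.2 ⟨q, rfl⟩

theorem exists_mul_eq_one_of_degree_eq_zero {f : OrePolynomial σ δ} (hf : f.degree = (0 : ℕ)) :
    ∃ u, u * f = 1 := by
  obtain ⟨h, h'⟩ := degree_eq_coe_iff.1 hf
  refine ⟨C σ δ (f.coeff 0)⁻¹, ext fun k => ?_⟩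
  rw [C_mul, coeff_smul, one_def, coeff_monomial]
  split_ifs with hk
  · rw [← hk, inv_mul_cancel₀ h]
  · rw [h' k (by omega), mul_zero]

/-- A left ideal strictly between `R f` and `R` gives a proper factorization of `f`. -/
theorem exists_eq_mul_of_not_isCoatom {f : OrePolynomial σ δ} {n : ℕ} (hf : f.degree = n)
    (hn : n ≠ 0) (h : ¬ IsCoatom (Ideal.span {f})) :
    ∃ (u v : OrePolynomial σ δ) (k l : ℕ), f = u * v ∧ u.degree = k ∧ v.degree = l ∧
      n = k + l ∧ k ≠ 0 ∧ l ≠ 0 := by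
  have hproper : Ideal.span {f} ≠ ⊤ := by
    rw [Ne, Ideal.eq_top_iff_one, Ideal.mem_span_singleton']
    rintro ⟨u, hu⟩
    have hu0 : u ≠ 0 := by
      rintro rfl
      exact ne_zero_of_degree_eq degree_one (by rw [← hu, zero_mul])
    obtain ⟨k, hk⟩ := exists_degree_eq hu0
    have := degree_mul hk hf
    rw [hu, degree_one, Nat.cast_inj] at this
    omega
  simp only [IsCoatom, not_and, not_forall] at h
  obtain ⟨J, hJ, hJtop⟩ := h hproper
  obtain ⟨v, l, rfl, hl, -⟩ :=
    exists_ideal_eq_span (hJ.le (Ideal.mem_span_singleton_self f)) hf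
  obtain ⟨u, rfl⟩ := Ideal.mem_span_singleton'.1 (hJ.le (Ideal.mem_span_singleton_self f))
  have hu0 : u ≠ 0 := by
    rintro rfl
    exact ne_zero_of_degree_eq hf (zero_mul v)
  obtain ⟨k, hk⟩ := exists_degree_eq hu0
  refine ⟨u, v, k, l, rfl, hk, hl, ?_, ?_, ?_⟩
  · have := degree_mul hk hl
    rw [hf, Nat.cast_inj] at this
    exact this
  · rintro rfl
    obtain ⟨w, hw⟩ := exists_mul_eq_one_of_degree_eq_zero hk
    refine hJ.not_ge ?_
    rw [Ideal.span_singleton_le_iff_mem, Ideal.mem_span_singleton']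
    exact ⟨w, by rw [← mul_assoc, hw, one_mul]⟩
  · rintro rfl
    obtain ⟨w, hw⟩ := exists_mul_eq_one_of_degree_eq_zero hl
    exact hJtop ((Ideal.eq_top_iff_one _).2 (Ideal.mem_span_singleton'.2 ⟨w, hw⟩))

end Division

end OrePolynomial

/-! ### Simple modules over a ring finite over its center -/

section SimpleModule

variable {R M : Type*} [Ring R] [AddCommGroup M] [Module R M]

/-- A tuple of elements of `M` onto which `R` acts densely, with an element of `R` that kills the
tuple but not `y`, can be extended by `y`. -/
theorem surjective_smul_cons [IsSimpleModule R M] {m : ℕ} {x : Fin m → M}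
    (hx : Function.Surjective fun (a : R) i => a • x i) {a : R} {y : M} (ha : ∀ i, a • x i = 0)
    (hy : a • y ≠ 0) :
    Function.Surjective fun (b : R) i => b • (Fin.cons y x : Fin (m + 1) → M) i := by
  intro z
  obtain ⟨b, hb⟩ := hx fun i => z i.succ
  obtain ⟨c, hc⟩ := IsSimpleModule.toSpanSingleton_surjective R hy (z 0 - b • y)
  have hc : c • a • y = z 0 - b • y := hc
  -- `b` settles the old coordinates; `c * a` corrects the new one and vanishes on the old ones.
  refine ⟨b + c * a, funext fun i => ?_⟩
  refine Fin.cases ?_ (fun i => ?_) i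
  · simp [add_smul, mul_smul, hc]
  · simpa [add_smul, mul_smul, ha] using congrFun hb i

/-- A Nakayama argument: a central `c` not killing `M` satisfies `cM = M` by simplicity. Hence an
ideal `J` containing the annihilator and such a `c` has `JM = M`; some element of `1 + J` then kills
`M`, so lies in `J`, and `J` is the whole center. -/
theorem annihilator_center_isMaximal [IsSimpleModule R M]
    [Module.Finite (Subring.center R) R] :
    (Module.annihilator (Subring.center R) M).IsMaximal := by
  have : Module.Finite (Subring.center R) M := Module.Finite.trans R M
  have := IsSimpleModule.nontrivial R M
  rw [Ideal.isMaximal_iff]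
  refine ⟨fun h => ?_, fun J c hJ hc hcJ => ?_⟩
  · obtain ⟨y, hy⟩ := exists_ne (0 : M)
    exact hy (by simpa using Module.mem_annihilator.1 h y)
  · have htop : (⊤ : Submodule (Subring.center R) M) ≤ J • ⊤ := by
      rw [Module.mem_annihilator, not_forall] at hc
      obtain ⟨y, hy⟩ := hc
      intro z _
      obtain ⟨b, hb⟩ := IsSimpleModule.toSpanSingleton_surjective R hy z
      have hb : b • (c : R) • y = z := hb
      rw [← mul_smul, Subring.mem_center_iff.1 c.2 b, mul_smul] at hb
      rw [← hb]
      exact Submodule.smul_mem_smul hcJ (Submodule.mem_top : b • y ∈ ⊤)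
    obtain ⟨e, he, he'⟩ := Submodule.exists_sub_one_mem_and_smul_eq_zero_of_fg_of_le_smul J ⊤
      Module.Finite.fg_top htop
    have : e ∈ J := hJ (Module.mem_annihilator.2 fun z => he' z Submodule.mem_top)
    simpa using J.sub_mem this he

/-- If `R` is free of rank `r` over its center and maps onto the `m`-th power of a simple module,
then `m² ≤ r`. -/
theorem mul_self_le_finrank_center [IsSimpleModule R M] [Module.Free (Subring.center R) R]
    [Module.Finite (Subring.center R) R] {m : ℕ} {x : Fin m → M}
    (hx : Function.Surjective fun (a : R) i => a • x i) :
    m * m ≤ Module.finrank (Subring.center R) R := by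
  have := IsSimpleModule.nontrivial R M
  have : Nontrivial R := Module.nontrivial R M
  have := annihilator_center_isMaximal (R := R) (M := M)
  set p := Module.annihilator (Subring.center R) M
  let : Field (Subring.center R ⧸ p) := Ideal.Quotient.field p
  let : Module (Subring.center R ⧸ p) M :=
    Module.IsTorsionBySet.module (I := p) (Module.isTorsionBySet_annihilator _ _)
  have hsmul : ∀ (c : Subring.center R) (y : M), Ideal.Quotient.mk p c • y = (c : R) • y :=
    fun c y => rfl
  have : IsScalarTower (Subring.center R) (Subring.center R ⧸ p) M :=
    Module.IsTorsionBySet.isScalarTower _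
  have : Module.Finite (Subring.center R) M := Module.Finite.trans R M
  have : Module.Finite (Subring.center R ⧸ p) M :=
    Module.Finite.of_restrictScalars_finite (Subring.center R) _ M
  -- Apply to a relation an `a` that sends `x j` to some `y ≠ 0` and the other `x i` to zero: the
  -- `j`-th coefficient kills `y`, which generates `M`, and being central it kills `M`.
  have hind : LinearIndependent (Subring.center R ⧸ p) x := by
    rw [Fintype.linearIndependent_iff]
    intro c hc j
    obtain ⟨y, hy⟩ := exists_ne (0 : M)
    obtain ⟨a, ha⟩ := hx (Pi.single j y)
    obtain ⟨d, rfl⟩ : ∃ d : Fin m → Subring.center R, c = fun i => Ideal.Quotient.mk p (d i) := by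
      choose d hd using fun i => Ideal.Quotient.mk_surjective (c i)
      exact ⟨d, funext fun i => (hd i).symm⟩
    simp only [hsmul] at hc
    have h1 : (d j : R) • y = 0 := by
      have h2 := congrArg (a • ·) hc
      simp only [Finset.smul_sum, smul_zero] at h2
      rw [Finset.sum_eq_single j] at h2
      · rw [← mul_smul, Subring.mem_center_iff.1 (d j).2 a, mul_smul] at h2
        have h3 : a • x j = y := by simpa using congrFun ha j
        rwa [h3] at h2
      · intro i _ hij
        have h3 : a • x i = 0 := by simpa [Pi.single_apply, hij] using congrFun ha i
        rw [← mul_smul, Subring.mem_center_iff.1 (d i).2 a, mul_smul, h3, smul_zero]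
      · simp
    rw [Ideal.Quotient.eq_zero_iff_mem, Module.mem_annihilator]
    intro z
    obtain ⟨b, hb⟩ := IsSimpleModule.toSpanSingleton_surjective R hy z
    have hb : b • y = z := hb
    change (d j : R) • z = 0
    rw [← hb, ← mul_smul, ← Subring.mem_center_iff.1 (d j).2 b, mul_smul, h1, smul_zero]
  have h1 : m ≤ Module.finrank (Subring.center R ⧸ p) M := by
    simpa using hind.fintype_card_le_finrank
  -- The images of a basis of `R` over its center span `Mᵐ` over the residue field.
  have h2 : Module.finrank (Subring.center R ⧸ p) (Fin m → M) ≤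
      Module.finrank (Subring.center R) R := by
    let b := Module.finBasis (Subring.center R) R
    have hspan : Submodule.span (Subring.center R ⧸ p) (Set.range fun j i => b j • x i) = ⊤ := by
      rw [eq_top_iff]
      intro z _
      obtain ⟨a, rfl⟩ := hx z
      change (fun i => a • x i) ∈ _
      rw [show (fun i => a • x i) =
        ∑ j, Ideal.Quotient.mk p (b.repr a j) • fun i => b j • x i from funext fun i => by
          conv_lhs => rw [← b.sum_repr a, Finset.sum_smul]
          rw [Finset.sum_apply]
          refine Finset.sum_congr rfl fun j _ => ?_
          rw [Pi.smul_apply, hsmul, ← mul_smul]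
          rfl]
      exact Submodule.sum_mem _ fun j _ => Submodule.smul_mem _ _
        (Submodule.subset_span ⟨j, rfl⟩)
    have := finrank_range_le_card (R := Subring.center R ⧸ p) (fun j i => b j • x i)
    rw [Set.finrank, hspan, finrank_top] at this
    simpa using this
  rw [Module.finrank_pi_fintype] at h2
  simp only [Finset.sum_const, Finset.card_univ, Fintype.card_fin, smul_eq_mul] at h2
  exact (Nat.mul_le_mul_left m h1).trans h2

/-- A simple module over a ring of rank `r` over its center contains `m ≤ √r` elements whose common
annihilator is the annihilator of the module. -/
theorem exists_forall_smul_eq_zero [IsSimpleModule R M] [Module.Free (Subring.center R) R]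
    [Module.Finite (Subring.center R) R] :
    ∃ (m : ℕ) (x : Fin m → M), m * m ≤ Module.finrank (Subring.center R) R ∧
      ∀ a : R, (∀ i, a • x i = 0) → ∀ y : M, a • y = 0 := by
  classical
  let S : ℕ → Prop := fun m => ∃ x : Fin m → M, Function.Surjective fun (a : R) i => a • x i
  -- `m ≤ m² ≤ r` makes the rank a legitimate search bound for the largest such `m`.
  have hbd : ∀ m, S m → m ≤ Module.finrank (Subring.center R) R := fun m ⟨x, hx⟩ =>
    (Nat.le_mul_self m).trans (mul_self_le_finrank_center hx)
  have h0 : S 0 := ⟨Fin.elim0, fun z => ⟨0, Subsingleton.elim _ _⟩⟩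
  set N := Module.finrank (Subring.center R) R
  obtain ⟨x, hx⟩ : S (Nat.findGreatest S N) := Nat.findGreatest_spec (Nat.zero_le _) h0
  refine ⟨_, x, mul_self_le_finrank_center hx, fun a ha y => ?_⟩
  by_contra hy
  have hS : S (Nat.findGreatest S N + 1) := ⟨_, surjective_smul_cons hx ha hy⟩
  exact absurd (Nat.le_findGreatest (hbd _ hS) hS) (by omega)

end SimpleModule

/-! ### Normal multiples of small degree -/

namespace OrePolynomial

variable {D : Type*} [DivisionRing D] {σ : D ≃+* D} {δ : SigmaDerivation σ}

theorem coeff_sum_C_mul_X_pow {N : ℕ} (c : Fin N → D) (k : ℕ) :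
    (∑ i, C σ δ (c i) * X σ δ ^ (i : ℕ)).coeff k = if h : k < N then c ⟨k, h⟩ else 0 := by
  simp only [coeff_sum, C_mul_X_pow, coeff_monomial]
  split_ifs with h
  · rw [Finset.sum_eq_single ⟨k, h⟩]
    · simp
    · exact fun i _ hi => if_neg fun hk => hi (Fin.ext hk)
    · simp
  · exact Finset.sum_eq_zero fun i _ => if_neg (by omega)

/-- A dimension count over `D`: the quotient is spanned by the classes of `Xⁱ` with `i < n`, while
polynomials of degree at most `m * n` form a space of dimension `m * n + 1`. -/
theorem exists_mul_mem_span {f : OrePolynomial σ δ} {n : ℕ} (hf : f.degree = n) {m : ℕ}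
    (x : Fin m → OrePolynomial σ δ ⧸ Ideal.span {f}) :
    ∃ (g : OrePolynomial σ δ) (k : ℕ), g.degree = k ∧ k ≤ m * n ∧ ∀ i, g • x i = 0 := by
  let : Module D (OrePolynomial σ δ ⧸ Ideal.span {f}) := Module.compHom _ (C σ δ)
  have hsmul : ∀ (a : D) (y : OrePolynomial σ δ ⧸ Ideal.span {f}), a • y = C σ δ a • y :=
    fun _ _ => rfl
  have hspan : Submodule.span D (Set.range fun i : Fin n =>
      (Submodule.Quotient.mk (X σ δ ^ (i : ℕ)) : OrePolynomial σ δ ⧸ Ideal.span {f})) = ⊤ := by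
    rw [eq_top_iff]
    intro z _
    obtain ⟨g, rfl⟩ := Submodule.Quotient.mk_surjective _ z
    obtain ⟨q, s, rfl, hs⟩ := exists_eq_mul_add hf g
    have h1 : (Submodule.Quotient.mk (q * f + s) : OrePolynomial σ δ ⧸ Ideal.span {f}) =
        Submodule.Quotient.mk s := by
      rw [Submodule.Quotient.eq, add_sub_cancel_right]
      exact Ideal.mem_span_singleton'.2 ⟨q, rfl⟩
    have h2 : s = ∑ i : Fin n, C σ δ (s.coeff i) * X σ δ ^ (i : ℕ) := ext fun k => by
      rw [coeff_sum_C_mul_X_pow]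
      split_ifs with h
      · rfl
      · exact hs k (by omega)
    rw [h1, h2, ← Submodule.mkQ_apply, map_sum]
    refine Submodule.sum_mem _ fun i _ => ?_
    rw [← smul_eq_mul, map_smul, ← hsmul]
    exact Submodule.smul_mem _ _ (Submodule.subset_span ⟨i, rfl⟩)
  have : Module.Finite D (OrePolynomial σ δ ⧸ Ideal.span {f}) :=
    ⟨hspan ▸ Submodule.fg_span (Set.finite_range _)⟩
  have hrank : Module.finrank D (OrePolynomial σ δ ⧸ Ideal.span {f}) ≤ n := by
    have := finrank_range_le_card (R := D) fun i : Fin n =>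
      (Submodule.Quotient.mk (X σ δ ^ (i : ℕ)) : OrePolynomial σ δ ⧸ Ideal.span {f})
    rw [Set.finrank, hspan, finrank_top] at this
    simpa using this
  let φ : (Fin (m * n + 1) → D) →ₗ[D] (Fin m → OrePolynomial σ δ ⧸ Ideal.span {f}) :=
    { toFun := fun c i => (∑ j, C σ δ (c j) * X σ δ ^ (j : ℕ)) • x i
      map_add' := fun c d => funext fun i => by
        simp only [Pi.add_apply, map_add, add_mul, Finset.sum_add_distrib, add_smul]
      map_smul' := fun a c => funext fun i => by
        simp only [Pi.smul_apply, smul_eq_mul, map_mul, mul_assoc, ← Finset.mul_sum, mul_smul,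
          hsmul, RingHom.id_apply] }
  have hφ : ¬ Function.Injective φ := fun h => by
    have h1 := LinearMap.finrank_le_finrank_of_injective h
    rw [Module.finrank_fin_fun, Module.finrank_pi_fintype] at h1
    simp only [Finset.sum_const, Finset.card_univ, Fintype.card_fin,
      smul_eq_mul] at h1
    have h2 := Nat.mul_le_mul_left m hrank
    omega
  rw [← LinearMap.ker_eq_bot, Submodule.eq_bot_iff] at hφ
  push Not at hφ
  obtain ⟨c, hc, hc0⟩ := hφ
  set g := ∑ j, C σ δ (c j) * X σ δ ^ (j : ℕ) with hg
  have hg0 : g ≠ 0 := fun h => hc0 <| funext fun j => by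
    have := coeff_sum_C_mul_X_pow (δ := δ) c j
    rw [← hg, h, dif_pos j.2] at this
    exact this.symm
  obtain ⟨k, hk⟩ := exists_degree_eq hg0
  refine ⟨g, k, hk, ?_, fun i => congrFun hc i⟩
  by_contra h
  refine (degree_eq_coe_iff.1 hk).1 ?_
  rw [hg, coeff_sum_C_mul_X_pow, dif_neg (by omega)]

variable [Module.Free (Subring.center (OrePolynomial σ δ)) (OrePolynomial σ δ)]
  [Module.Finite (Subring.center (OrePolynomial σ δ)) (OrePolynomial σ δ)]

/-- The annihilator of `R/Rf` is twosided and, as a left ideal, principal; its generator kills the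
class of `1`, so it lies in `Rf`. -/
theorem exists_normal_mem_span_of_isCoatom {f : OrePolynomial σ δ} {n : ℕ} (hf : f.degree = n)
    (h : IsCoatom (Ideal.span {f})) :
    ∃ (g : OrePolynomial σ δ) (k : ℕ), g.degree = k ∧
      (k : ℝ) ≤ √(Module.finrank (Subring.center (OrePolynomial σ δ)) (OrePolynomial σ δ)) * n ∧
      (∀ a, ∃ b, g * a = b * g) ∧ g ∈ Ideal.span {f} := by
  have : IsSimpleModule (OrePolynomial σ δ) (OrePolynomial σ δ ⧸ Ideal.span {f}) :=
    isSimpleModule_iff_isCoatom.2 h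
  obtain ⟨m, x, hm, hx⟩ := exists_forall_smul_eq_zero (R := OrePolynomial σ δ)
    (M := OrePolynomial σ δ ⧸ Ideal.span {f})
  obtain ⟨g₀, k₀, hk₀, hle, hg₀⟩ := exists_mul_mem_span hf x
  obtain ⟨g, k, hP, hk, hkk⟩ := exists_ideal_eq_span
    (Module.mem_annihilator.2 (hx g₀ hg₀)) hk₀
  have hgP := hP ▸ Ideal.mem_span_singleton_self g
  refine ⟨g, k, hk, ?_, fun a => ?_, ?_⟩
  · have h1 : (m : ℝ) ≤
        √(Module.finrank (Subring.center (OrePolynomial σ δ)) (OrePolynomial σ δ)) :=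
      Real.le_sqrt_of_sq_le (by rw [sq]; exact_mod_cast hm)
    have h2 : (k : ℝ) ≤ m * n := by exact_mod_cast hkk.trans hle
    exact h2.trans (by gcongr)
  · have : g * a ∈ Ideal.span {g} := by
      rw [← hP, Module.mem_annihilator]
      intro y
      rw [mul_smul]
      exact Module.mem_annihilator.1 hgP _
    obtain ⟨b, hb⟩ := Ideal.mem_span_singleton'.1 this
    exact ⟨b, hb.symm⟩
  · have := Module.mem_annihilator.1 hgP (Submodule.Quotient.mk 1)
    rw [← Submodule.Quotient.mk_smul, Submodule.Quotient.mk_eq_zero, smul_eq_mul, mul_one] at this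
    exact this

theorem exists_normal_mem_span (n : ℕ) : ∀ f : OrePolynomial σ δ, f.degree = n →
    ∃ (g : OrePolynomial σ δ) (k : ℕ), g.degree = k ∧
      (k : ℝ) ≤ √(Module.finrank (Subring.center (OrePolynomial σ δ)) (OrePolynomial σ δ)) * n ∧
      (∀ a, ∃ b, g * a = b * g) ∧ g ∈ Ideal.span {f} := by
  induction n using Nat.strong_induction_on with
  | _ n ih =>
    intro f hf
    rcases eq_or_ne n 0 with rfl | hn
    · obtain ⟨u, hu⟩ := exists_mul_eq_one_of_degree_eq_zero hf
      exact ⟨1, 0, degree_one, by simp, fun a => ⟨a, by simp⟩,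
        Ideal.mem_span_singleton'.2 ⟨u, hu⟩⟩
    by_cases hco : IsCoatom (Ideal.span {f})
    · exact exists_normal_mem_span_of_isCoatom hf hco
    obtain ⟨u, v, k, l, rfl, hu, hv, rfl, hk, hl⟩ := exists_eq_mul_of_not_isCoatom hf hn hco
    obtain ⟨g₁, k₁, hg₁, hk₁, hn₁, hm₁⟩ := ih k (by omega) u hu
    obtain ⟨g₂, k₂, hg₂, hk₂, hn₂, hm₂⟩ := ih l (by omega) v hv
    refine ⟨g₁ * g₂, k₁ + k₂, degree_mul hg₁ hg₂, ?_, fun a => ?_, ?_⟩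
    · push_cast
      rw [mul_add]
      exact add_le_add hk₁ hk₂
    · obtain ⟨b, hb⟩ := hn₂ a
      obtain ⟨c, hc⟩ := hn₁ b
      exact ⟨c, by rw [mul_assoc, hb, ← mul_assoc, hc, mul_assoc]⟩
    · obtain ⟨w, rfl⟩ := Ideal.mem_span_singleton'.1 hm₂
      obtain ⟨c, hc⟩ := hn₁ w
      obtain ⟨d, rfl⟩ := Ideal.mem_span_singleton'.1 hm₁
      -- With `g₁ = d u`, `g₂ = w v` and `g₁ w = c g₁`, the product `g₁ g₂` equals `c d u v`.
      exact Ideal.mem_span_singleton'.2 ⟨c * d, by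
        rw [← mul_assoc _ w v, hc]; simp only [mul_assoc]⟩

end OrePolynomial

theorem theorem3p6 {D : Type*} [DivisionRing D] (σ : D ≃+* D) (δ : SigmaDerivation σ)
    [Module.Free (Subring.center (OrePolynomial σ δ)) (OrePolynomial σ δ)]
    [Module.Finite (Subring.center (OrePolynomial σ δ)) (OrePolynomial σ δ)]
    (r : ℕ) (hr : Module.finrank (Subring.center (OrePolynomial σ δ)) (OrePolynomial σ δ) = r)
    (f fstar : OrePolynomial σ δ) (hbound : IsBound f fstar)
    (hcentral : fstar ∈ Subring.center (OrePolynomial σ δ)) :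
    fstar.degree.map (fun n : ℕ => (n : ℝ)) ≤
      (Real.sqrt (r : ℝ) : WithBot ℝ) * f.degree.map (fun n : ℕ => (n : ℝ)) := by
  rcases eq_or_ne f 0 with rfl | hf
  · have h := hbound.isGreatest.1.2 (Ideal.mem_span_singleton_self fstar)
    rw [Ideal.span_singleton_zero, Ideal.mem_bot] at h
    rw [h, OrePolynomial.degree_zero, WithBot.map_bot]
    exact bot_le
  obtain ⟨n, hn⟩ := OrePolynomial.exists_degree_eq hf
  obtain ⟨g, k, hk, hle, hnormal, hg⟩ := OrePolynomial.exists_normal_mem_span n f hn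
  have htwo : (Ideal.span {g}).IsTwoSided := ⟨fun {a} b ha => by
    obtain ⟨c, rfl⟩ := Ideal.mem_span_singleton'.1 ha
    obtain ⟨d, hd⟩ := hnormal b
    exact Ideal.mem_span_singleton'.2 ⟨c * d, by rw [mul_assoc, mul_assoc, hd]⟩⟩
  -- Maximality of the bound puts `g` in `R f*`.
  obtain ⟨u, hu⟩ := Ideal.mem_span_singleton'.1 <| hbound.isGreatest.2
    ⟨htwo, by simpa [Ideal.span_singleton_le_iff_mem] using hg⟩ (Ideal.mem_span_singleton_self g)
  have hg0 := OrePolynomial.ne_zero_of_degree_eq hk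
  obtain ⟨l, hl⟩ := OrePolynomial.exists_degree_eq (f := u) (by rintro rfl; simp_all)
  obtain ⟨s, hs⟩ := OrePolynomial.exists_degree_eq (f := fstar) (by rintro rfl; simp_all)
  have hkls := OrePolynomial.degree_mul hl hs
  rw [hu, hk, Nat.cast_inj] at hkls
  have hsk : (s : ℝ) ≤ k := by exact_mod_cast (by omega : s ≤ k)
  rw [hn, hs]
  change ((s : ℝ) : WithBot ℝ) ≤ (√(r : ℝ) : WithBot ℝ) * ((n : ℝ) : WithBot ℝ)
  rw [← WithBot.coe_mul, WithBot.coe_le_coe, ← hr]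
  exact hsk.trans hle
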